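/- \textbf{Theorem (Combinatorial Reduction to Normal Crossings).} \emph{Definitions.} A \emph{support fabric} is a pair $\mathcal F=(I,\mathcal H)$ where $I$ is a finite set and $\mathcal H$ is a set of subsets of $I$ (the \emph{strata}) such that every subset of a stratum is a stratum. For a finite set $J$ and $A\subset\mathbb R^J_{\ge 0}$ let $[[A]]$ be the convex hull of $A+\mathbb R^J_{\ge 0}$. A \emph{Newton polyhedra system} $\mathcal N=(\mathcal F;\{N_J\}_{J\in\mathcal H})$ over $\mathcal F$ consists, for each $J\in\mathcal H$, of a non-empty polyhedron $N_J\subset\mathbb R^J_{\ge 0}$ of the form $N_J=[[A]]$ with $A\subset\mathbb Z^J_{\ge 0}$, such that for all strata $J_1\subset J_2$ the polyhedron $N_{J_1}$ is the image of $N_{J_2}$ under the restriction map $\mathbb R^{J_2}\to\mathbb R^{J_1}$. Let $J\in\mathcal H$ be a non-empty stratum. The \emph{blow-up} $\pi_J(\mathcal F)=(I',\mathcal H')$ of $\mathcal F$ centered in $J$ has $I'=I\cup\{\infty\}$, $\infty\notin I$, and its strata are the $K\in\mathcal H$ with $J\not\subset K$ together with the sets $(K\setminus J)\cup A\cup\{\infty\}$,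 where $K\in\mathcal H$, $K\supset J$ and $A\subsetneq J$. The \emph{total transform} of $\mathcal N$ centered in $J$ is the Newton polyhedra system over $\pi_J(\mathcal F)$ whose polyhedron at $J'\in\mathcal H'$ is $N_{J'}$ if $\infty\notin J'$, and is $[[\lambda_{J'}(N_K)]]$ if $J'=(K\setminus J)\cup A\cup\{\infty\}$ as above, where $\lambda_{J'}:\mathbb R^K\to\mathbb R^{J'}$ is given by $\lambda_{J'}(\sigma)(j)=\sigma(j)$ for $j\ne\infty$ and $\lambda_{J'}(\sigma)(\infty)=\sum_{j\in J}\sigma(j)$. A Newton polyhedra system has \emph{normal crossings} if each of its polyhedra has a single vertex. \emph{Statement.} For every Newton polyhedra system $\mathcal N$ there is a finite sequence of total transforms (possibly of length $k=0$), each centered in some non-empty stratum of the preceding system, $$\mathcal N=\mathcal N_0\to\mathcal N_1\to\cdots\to\mathcal N_k,$$ such that $\mathcal N_k$ has normal crossings. -/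

import Mathlib

open scoped Pointwise

/-- A support fabric `(I, H)`: a finite index set `I` and a set `H` of subsets of `I` (the strata)
which is open for the Zariski topology, i.e. `J ∈ H` implies that every subset of `J` is in `H`. -/
structure SupportFabric where
  Idx : Type*
  [fintypeIdx : Fintype Idx]
  [decEqIdx : DecidableEq Idx]
  strata : Set (Finset Idx)
  isOpen_strata : ∀ J ∈ strata, ∀ J₁ : Finset Idx, J₁ ⊆ J → J₁ ∈ strata

attribute [instance] SupportFabric.fintypeIdx SupportFabric.decEqIdx

namespace SupportFabric

/-- The strata of the blow-up centered in `J`, as sets of indices in `I ∪ {∞}` (here `Option I`, with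
`∞ = none`). The strata outside the exceptional divisor are the `K ∈ H` with `J ⊄ K`; the
exceptional ones are the `(K \ J) ∪ A ∪ {∞}` with `J ⊆ K ∈ H` and `A ⊊ J`. -/
def blowUpStrata (F : SupportFabric) (J : Finset F.Idx) : Set (Finset (Option F.Idx)) :=
  {J' | ∃ K ∈ F.strata, ¬ J ⊆ K ∧ J' = K.map Function.Embedding.some} ∪
  {J' | ∃ K ∈ F.strata, J ⊆ K ∧ ∃ A : Finset F.Idx, A ⊂ J ∧ J' = Finset.insertNone ((K \ J) ∪ A)}

/-- The map `π_J^#` from the strata of the blow-up to the strata of the fabric: the identity on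
strata `J'` not containing `∞`, and `(K \ J) ∪ A ∪ {∞} ↦ K` on the exceptional ones; in the latter
case `K = (J' \ {∞}) ∪ J`. -/
def blowUpProj {I : Type*} [DecidableEq I] (J : Finset I) (J' : Finset (Option I)) : Finset I :=
  if none ∈ J' then J'.eraseNone ∪ J else J'.eraseNone

theorem blowUpProj_map {I : Type*} [DecidableEq I] (J K : Finset I) :
    blowUpProj J (K.map Function.Embedding.some) = K := by
  ext x
  simp [blowUpProj]

theorem blowUpProj_insertNone {I : Type*} [DecidableEq I] {J K A : Finset I}
    (hJ : J ⊆ K) (hA : A ⊂ J) :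
    blowUpProj J (Finset.insertNone ((K \ J) ∪ A)) = K := by
  ext x
  have h1 := @hJ x
  have h2 : x ∈ A → x ∈ J := fun hx => hA.1 hx
  simp only [blowUpProj, Finset.none_mem_insertNone, if_true, Finset.eraseNone_insertNone,
    Finset.mem_union, Finset.mem_sdiff]
  tauto

theorem eraseNone_subset_blowUpProj {I : Type*} [DecidableEq I] (J : Finset I)
    (J' : Finset (Option I)) : J'.eraseNone ⊆ blowUpProj J J' := by
  unfold blowUpProj
  split_ifs
  · exact Finset.subset_union_left
  · exact subset_rfl

theorem subset_blowUpProj {I : Type*} [DecidableEq I] {J : Finset I}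
    {J' : Finset (Option I)} (h : none ∈ J') : J ⊆ blowUpProj J J' := by
  rw [blowUpProj, if_pos h]
  exact Finset.subset_union_right

theorem blowUpProj_mono {I : Type*} [DecidableEq I] (J : Finset I)
    {J₁ J₂ : Finset (Option I)} (h : J₁ ⊆ J₂) : blowUpProj J J₁ ⊆ blowUpProj J J₂ := by
  have he : J₁.eraseNone ⊆ J₂.eraseNone := fun x hx => by
    simp only [Finset.mem_eraseNone] at hx ⊢
    exact h hx
  by_cases h1 : none ∈ J₁
  · rw [blowUpProj, if_pos h1, blowUpProj, if_pos (h h1)]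
    exact Finset.union_subset_union he subset_rfl
  · rw [blowUpProj, if_neg h1]
    exact he.trans (eraseNone_subset_blowUpProj J J₂)

theorem mem_blowUpStrata (F : SupportFabric) (J : Finset F.Idx) (J' : Finset (Option F.Idx)) :
    J' ∈ F.blowUpStrata J ↔ ¬ J ⊆ J'.eraseNone ∧ blowUpProj J J' ∈ F.strata := by
  constructor
  · rintro (⟨K, hK, hJK, rfl⟩ | ⟨K, hK, hJK, A, hA, rfl⟩)
    · rw [blowUpProj_map]
      exact ⟨by simpa using hJK, hK⟩
    · rw [blowUpProj_insertNone hJK hA]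
      refine ⟨fun h => hA.2 fun x hx => ?_, hK⟩
      have := h hx
      simp only [Finset.eraseNone_insertNone, Finset.mem_union, Finset.mem_sdiff] at this
      tauto
  · rintro ⟨h1, h2⟩
    by_cases hn : none ∈ J'
    · rw [blowUpProj, if_pos hn] at h2
      refine Or.inr ⟨_, h2, Finset.subset_union_right, J'.eraseNone ∩ J,
        ⟨Finset.inter_subset_right, fun h => h1 fun x hx => (Finset.mem_inter.1 (h hx)).1⟩, ?_⟩
      ext x
      cases x with
      | none => simpa using hn
      | some x =>
        simp only [Finset.some_mem_insertNone, Finset.mem_union, Finset.mem_sdiff,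
          Finset.mem_inter, Finset.mem_eraseNone]
        tauto
    · rw [blowUpProj, if_neg hn] at h2
      refine Or.inl ⟨_, h2, h1, ?_⟩
      ext x
      cases x with
      | none => simpa using hn
      | some x => simp

theorem blowUpProj_mem (F : SupportFabric) (J : Finset F.Idx) {J' : Finset (Option F.Idx)}
    (h : J' ∈ F.blowUpStrata J) : blowUpProj J J' ∈ F.strata :=
  ((F.mem_blowUpStrata J J').1 h).2

/-- The blow-up of a support fabric centered in `J`. -/
abbrev blowUp (F : SupportFabric) (J : Finset F.Idx) : SupportFabric where
  Idx := Option F.Idx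
  strata := F.blowUpStrata J
  isOpen_strata := by
    intro J₂ h2 J₁ h12
    rw [mem_blowUpStrata] at h2 ⊢
    refine ⟨fun h => h2.1 (h.trans fun x hx => ?_),
      F.isOpen_strata _ h2.2 _ (blowUpProj_mono J h12)⟩
    simp only [Finset.mem_eraseNone] at hx ⊢
    exact h12 hx

end SupportFabric

/-- The positive convex hull `[[A]]`, the convex hull of `A + ℝ_{≥0}^J`. -/
def positiveHull {ι : Type*} (A : Set (ι → ℝ)) : Set (ι → ℝ) :=
  convexHull ℝ (A + Set.Ici (0 : ι → ℝ))

theorem subset_positiveHull {ι : Type*} (A : Set (ι → ℝ)) : A ⊆ positiveHull A := fun a ha =>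
  subset_convexHull ℝ _ ⟨a, ha, 0, Set.mem_Ici.2 le_rfl, add_zero a⟩

theorem positiveHull_mono {ι : Type*} {A B : Set (ι → ℝ)} (h : A ⊆ B) :
    positiveHull A ⊆ positiveHull B :=
  convexHull_mono (Set.add_subset_add_right h)

theorem positiveHull_positiveHull {ι : Type*} (A : Set (ι → ℝ)) :
    positiveHull (positiveHull A) = positiveHull A := by
  refine subset_antisymm ?_ (subset_positiveHull _)
  have h : Set.Ici (0 : ι → ℝ) + Set.Ici (0 : ι → ℝ) ⊆ Set.Ici (0 : ι → ℝ) := by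
    rintro _ ⟨x, hx, y, hy, rfl⟩
    exact Set.mem_Ici.2 (add_nonneg (Set.mem_Ici.1 hx) (Set.mem_Ici.1 hy))
  refine convexHull_min ?_ (convex_convexHull ℝ _)
  calc positiveHull A + Set.Ici (0 : ι → ℝ)
      ⊆ convexHull ℝ (A + Set.Ici (0 : ι → ℝ)) + convexHull ℝ (Set.Ici (0 : ι → ℝ)) :=
        Set.add_subset_add_left (subset_convexHull ℝ _)
    _ = convexHull ℝ (A + Set.Ici (0 : ι → ℝ) + Set.Ici (0 : ι → ℝ)) := (convexHull_add _ _).symm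
    _ ⊆ _ := convexHull_mono (by rw [add_assoc]; exact Set.add_subset_add_left h)

theorem image_positiveHull {ι κ : Type*} (f : (ι → ℝ) →ₗ[ℝ] (κ → ℝ)) (A : Set (ι → ℝ)) :
    f '' positiveHull A = convexHull ℝ (f '' A + f '' Set.Ici 0) := by
  rw [positiveHull, f.image_convexHull, Set.image_add]

theorem image_positiveHull_of_image_eq {ι κ : Type*} (f : (ι → ℝ) →ₗ[ℝ] (κ → ℝ))
    (hf : f '' Set.Ici 0 = Set.Ici 0) (A : Set (ι → ℝ)) :
    f '' positiveHull A = positiveHull (f '' A) := by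
  rw [image_positiveHull, hf, positiveHull]

theorem positiveHull_image_positiveHull {ι κ : Type*} (f : (ι → ℝ) →ₗ[ℝ] (κ → ℝ))
    (hf : ∀ x, 0 ≤ x → 0 ≤ f x) (A : Set (ι → ℝ)) :
    positiveHull (f '' positiveHull A) = positiveHull (f '' A) := by
  refine subset_antisymm ?_ (positiveHull_mono (Set.image_mono (subset_positiveHull A)))
  rw [← positiveHull_positiveHull (f '' A)]
  refine positiveHull_mono ?_
  rw [image_positiveHull]
  refine convexHull_mono (Set.add_subset_add_left ?_)
  rintro _ ⟨x, hx, rfl⟩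
  exact hf x hx

/-- `Δ` is a characteristic polyhedron with denominator `d`: it is `[[A]]` for some
`A ⊆ (1/d) ℤ_{≥0}^J`. -/
def IsCharPolyhedron {ι : Type*} (d : ℕ) (Δ : Set (ι → ℝ)) : Prop :=
  ∃ A : Set (ι → ℝ), (∀ a ∈ A, ∀ j, ∃ n : ℕ, a j = (n : ℝ) / d) ∧ Δ = positiveHull A

/-- A polyhedra system with denominator `d` over a support fabric: for each stratum `J` a
characteristic polyhedron `Δ_J ⊆ ℝ_{≥0}^J` with denominator `d`, such that `Δ_{J₁}` is the
projection of `Δ_{J₂}` for all strata `J₁ ⊆ J₂`. -/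
structure PolyhedraSystem (d : ℕ) where
  fabric : SupportFabric
  denom_pos : 0 < d
  poly : (J : fabric.strata) → Set (J.1 → ℝ)
  isCharPolyhedron : ∀ J, IsCharPolyhedron d (poly J)
  compat : ∀ (J₁ J₂ : fabric.strata) (h : J₁.1 ⊆ J₂.1),
    poly J₁ = Finset.restrict₂ (π := fun _ => ℝ) h '' poly J₂

/-- A Newton polyhedra system is a polyhedra system with denominator `1`. -/
abbrev NewtonPolyhedraSystem := PolyhedraSystem 1

/-- The linear map `λ_{J'} : ℝ^K → ℝ^{J'}`, `K = π_J^#(J')`, which keeps the coordinates `j ≠ ∞` and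
has `∞`-coordinate `∑_{j ∈ J} σ(j)`. If `∞ ∉ J'`, it is the identification `ℝ^{J'} = ℝ^{J'}`. -/
def blowUpMap {I : Type*} [DecidableEq I] (J : Finset I) (J' : Finset (Option I)) :
    (SupportFabric.blowUpProj J J' → ℝ) →ₗ[ℝ] (J' → ℝ) where
  toFun σ
    | ⟨some i, h⟩ =>
        σ ⟨i, SupportFabric.eraseNone_subset_blowUpProj J J' (Finset.mem_eraseNone.2 h)⟩
    | ⟨none, h⟩ => ∑ j : J, σ ⟨j, SupportFabric.subset_blowUpProj h j.2⟩
  map_add' σ τ := by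
    funext x
    rcases x with ⟨_ | i, h⟩
    · simp [Finset.sum_add_distrib]
    · simp
  map_smul' c σ := by
    funext x
    rcases x with ⟨_ | i, h⟩
    · simp [Finset.mul_sum]
    · simp

theorem blowUpMap_nonneg {I : Type*} [DecidableEq I] (J : Finset I) (J' : Finset (Option I))
    (σ : SupportFabric.blowUpProj J J' → ℝ) (h : 0 ≤ σ) : 0 ≤ blowUpMap J J' σ := by
  rintro ⟨_ | i, hi⟩
  · exact Finset.sum_nonneg fun j _ => h _
  · exact h _

theorem blowUpMap_image_Ici {I : Type*} [DecidableEq I] (J : Finset I) {J' : Finset (Option I)}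
    (h : none ∉ J') : blowUpMap J J' '' Set.Ici 0 = Set.Ici 0 := by
  refine subset_antisymm ?_ fun y hy => ?_
  · rintro _ ⟨x, hx, rfl⟩
    exact blowUpMap_nonneg J J' x hx
  · have hm : ∀ i : SupportFabric.blowUpProj J J', some i.1 ∈ J' := fun i => by
      have he : SupportFabric.blowUpProj J J' = J'.eraseNone := if_neg h
      exact Finset.mem_eraseNone.1 (he ▸ i.2)
    refine ⟨fun i => y ⟨some i.1, hm i⟩, Set.mem_Ici.2 fun i => hy _, ?_⟩
    funext x
    rcases x with ⟨_ | i, hi⟩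
    · exact absurd hi h
    · rfl

theorem restrict_comp_blowUpMap {I : Type*} [DecidableEq I] (J : Finset I)
    {J₁ J₂ : Finset (Option I)} (h : J₁ ⊆ J₂) (σ : SupportFabric.blowUpProj J J₂ → ℝ) :
    Finset.restrict₂ (π := fun _ => ℝ) h (blowUpMap J J₂ σ) =
      blowUpMap J J₁
        (Finset.restrict₂ (π := fun _ => ℝ) (SupportFabric.blowUpProj_mono J h) σ) := by
  funext x
  rcases x with ⟨_ | i, hi⟩ <;> rfl

theorem restrict_image_positiveHull {I : Type*} {J₁ J₂ : Finset I} (h : J₁ ⊆ J₂)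
    (A : Set (J₂ → ℝ)) :
    Finset.restrict₂ (π := fun _ => ℝ) h '' positiveHull A =
      positiveHull (Finset.restrict₂ (π := fun _ => ℝ) h '' A) := by
  classical
  refine image_positiveHull_of_image_eq
    (LinearMap.funLeft ℝ ℝ fun i : J₁ => (⟨i.1, h i.2⟩ : J₂)) ?_ A
  refine subset_antisymm ?_ fun y hy => ?_
  · rintro _ ⟨x, hx, rfl⟩
    exact Set.mem_Ici.2 fun i => hx _
  · refine ⟨fun i => if hi : i.1 ∈ J₁ then y ⟨i.1, hi⟩ else 0, Set.mem_Ici.2 fun i => ?_, ?_⟩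
    · dsimp only
      split_ifs with hi
      · exact hy _
      · exact le_rfl
    · funext i
      simp [LinearMap.funLeft]

namespace PolyhedraSystem

/-- The polyhedra of the total transform: `Δ⁰_{J'} = [[λ_{J'}(Δ_K)]]`, `K = π_J^#(J')`, if `∞ ∈ J'`, and
`Δ⁰_{J'} = Δ_{J'}` (with indices in `I` regarded as indices in `I ∪ {∞}`) otherwise. -/
noncomputable def totalPoly {d : ℕ} (D : PolyhedraSystem d) (J : Finset D.fabric.Idx)
    (J' : D.fabric.blowUpStrata J) :
    Set (J'.1 → ℝ) :=
  let ΔK := D.poly ⟨SupportFabric.blowUpProj J J'.1, D.fabric.blowUpProj_mem J J'.2⟩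
  if none ∈ J'.1 then positiveHull (blowUpMap J J'.1 '' ΔK) else blowUpMap J J'.1 '' ΔK

theorem totalPoly_eq {d : ℕ} (D : PolyhedraSystem d) (J : Finset D.fabric.Idx)
    (J' : D.fabric.blowUpStrata J) :
    D.totalPoly J J' = positiveHull (blowUpMap J J'.1 ''
      D.poly ⟨SupportFabric.blowUpProj J J'.1, D.fabric.blowUpProj_mem J J'.2⟩) := by
  unfold totalPoly
  split_ifs with h
  · rfl
  · obtain ⟨A, -, hA⟩ := D.isCharPolyhedron
      ⟨SupportFabric.blowUpProj J J'.1, D.fabric.blowUpProj_mem J J'.2⟩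
    rw [hA, image_positiveHull_of_image_eq _ (blowUpMap_image_Ici J h), positiveHull_positiveHull]

theorem isCharPolyhedron_totalPoly {d : ℕ} (D : PolyhedraSystem d) (J : Finset D.fabric.Idx)
    (J' : D.fabric.blowUpStrata J) : IsCharPolyhedron d (D.totalPoly J J') := by
  obtain ⟨A, hd, hA⟩ := D.isCharPolyhedron
    ⟨SupportFabric.blowUpProj J J'.1, D.fabric.blowUpProj_mem J J'.2⟩
  refine ⟨blowUpMap J J'.1 '' A, ?_, ?_⟩
  · rintro _ ⟨a, ha, rfl⟩ ⟨_ | i, hi⟩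
    · choose n hn using hd a ha
      refine ⟨∑ j : J, n ⟨j, SupportFabric.subset_blowUpProj hi j.2⟩, ?_⟩
      rw [Nat.cast_sum, Finset.sum_div]
      exact Finset.sum_congr rfl fun j _ => hn _
    · exact hd a ha _
  · rw [totalPoly_eq, hA]
    exact positiveHull_image_positiveHull _ (blowUpMap_nonneg J J'.1) A

theorem compat_totalPoly {d : ℕ} (D : PolyhedraSystem d) (J : Finset D.fabric.Idx)
    (J₁ J₂ : D.fabric.blowUpStrata J) (h : J₁.1 ⊆ J₂.1) :
    D.totalPoly J J₁ = Finset.restrict₂ (π := fun _ => ℝ) h '' D.totalPoly J J₂ := by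
  rw [totalPoly_eq, totalPoly_eq, restrict_image_positiveHull,
    D.compat ⟨_, D.fabric.blowUpProj_mem J J₁.2⟩ ⟨_, D.fabric.blowUpProj_mem J J₂.2⟩
      (SupportFabric.blowUpProj_mono J h), Set.image_image, Set.image_image]
  congr 1
  exact Set.image_congr fun σ _ => (restrict_comp_blowUpMap J h σ).symm

/-- The total transform of a polyhedra system centered in `J`. -/
noncomputable def totalTransform {d : ℕ} (D : PolyhedraSystem d) (J : Finset D.fabric.Idx) :
    PolyhedraSystem d where
  fabric := D.fabric.blowUp J
  denom_pos := D.denom_pos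
  poly := D.totalPoly J
  isCharPolyhedron := D.isCharPolyhedron_totalPoly J
  compat := D.compat_totalPoly J

/-- `D'` is the total transform of `D` centered in some non-empty stratum. -/
def IsTotalTransform {d : ℕ} (D D' : PolyhedraSystem d) : Prop :=
  ∃ J ∈ D.fabric.strata, J.Nonempty ∧ D' = D.totalTransform J

/-- Normal crossings: each polyhedron has a single vertex (extreme point). -/
def HasNormalCrossings (N : NewtonPolyhedraSystem) : Prop :=
  ∀ J : N.fabric.strata, ∃ v, Set.extremePoints ℝ (N.poly J) = {v}

end PolyhedraSystem

/-!
Let `x` and `y` be two exponent vectors on the index set of a support fabric. They fail to be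
comparable on some stratum exactly when there is a conflict: a stratum `{i, j}` with `x i < y i` and
`y j < x j`. Its gap is `(y i - x i) + (x j - y j)`. Blowing up a conflict `{i, j}` of maximal gap
separates `i` from `j`, and since the new coordinate of `x` is `x i + x j`, a conflict between `∞`
and `l` has a smaller gap than the conflict between `i` or `j` and `l` it comes from. So the
multiset of gaps decreases in the Dershowitz–Manna order, and finitely many blow-ups make `x`
and `y` comparable on every stratum. Comparability survives further blow-ups, so a finite family of
exponent vectors can be treated one pair at a time.

By Dickson's lemma all the polyhedra of a system are spanned by one finite family of exponent
vectors, and total transforms act on that family through the sums above. Once its members are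
pairwise comparable on every stratum, each polyhedron is spanned by the least of them.
-/

theorem exists_isLeast_of_isChain {α : Type*} [Preorder α] {s : Set α} (hs : s.Finite)
    (hne : s.Nonempty) (hc : IsChain (· ≤ ·) s) : ∃ a, IsLeast s a := by
  obtain ⟨a, ha⟩ := hs.exists_minimal hne
  exact ⟨a, ha.1, fun b hb => (hc.total ha.1 hb).elim id fun hba => ha.2 hb hba⟩

theorem finite_setOf_minimal {α : Type*} [PartialOrder α] [WellQuasiOrderedLE α] (P : α → Prop) :
    {a | Minimal P a}.Finite :=
  (setOfPred_minimal_antichain P).finite_of_partiallyWellOrderedOn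
    (Set.isPWO_of_wellQuasiOrderedLE _)

theorem exists_nat_forall_le_div {κ 𝕜 : Type*} [Finite κ] [Field 𝕜] [LinearOrder 𝕜]
    [IsStrictOrderedRing 𝕜] [Archimedean 𝕜] {d : 𝕜} (hd : 0 < d) (f : κ → 𝕜) :
    ∃ n : ℕ, ∀ k, f k ≤ n / d := by
  obtain ⟨B, hB⟩ := (Set.finite_range f).bddAbove
  obtain ⟨n, hn⟩ := exists_nat_ge (B * d)
  exact ⟨n, fun k => (hB ⟨k, rfl⟩).trans ((le_div_iff₀ hd).2 hn)⟩

theorem isDershowitzMannaLT_map_of_forall_lt_or_exists {α β γ : Type*} [Preorder γ]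
    {s : Finset α} {t : Finset β} {f : α → γ} {g : β → γ} {e : α} (he : e ∈ s) (φ : α → β)
    (h : ∀ q ∈ t, g q < f e ∨ ∃ p ∈ s, p ≠ e ∧ φ p = q ∧ f p = g q) :
    (t.val.map g).IsDershowitzMannaLT (s.val.map f) := by
  classical
  have : Nonempty α := ⟨e⟩
  let T := {q ∈ t | ¬ g q < f e}
  have hT : ∀ q ∈ T, ∃ p ∈ s.erase e, φ p = q ∧ f p = g q := fun q hq => by
    obtain ⟨hqt, hq⟩ := Finset.mem_filter.1 hq
    obtain ⟨p, hp, hpe, hpq⟩ := (h q hqt).resolve_left hq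
    exact ⟨p, Finset.mem_erase.2 ⟨hpe, hp⟩, hpq⟩
  choose! ψ hψs hφψ hfψ using hT
  have hle : T.val.map g ≤ (s.erase e).val.map f := calc
    T.val.map g = (T.val.map ψ).map f := by
      rw [Multiset.map_map]
      exact Multiset.map_congr rfl fun q hq => (hfψ q hq).symm
    _ = (T.image ψ).val.map f := by
      rw [Finset.image_val_of_injOn (Set.LeftInvOn.injOn hφψ)]
    _ ≤ (s.erase e).val.map f :=
      Multiset.map_le_map (Finset.val_le_iff.2 (Finset.image_subset_iff.2 hψs))
  obtain ⟨Z, hZ⟩ := Multiset.le_iff_exists_add.1 hle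
  refine ⟨T.val.map g, {q ∈ t | g q < f e}.val.map g, f e ::ₘ Z,
    Multiset.cons_ne_zero, ?_, ?_, ?_⟩
  · rw [add_comm, ← Multiset.map_add]
    exact congrArg _ (Multiset.filter_add_not _ _).symm
  · rw [Multiset.add_cons, ← hZ, ← Multiset.map_cons, Finset.erase_val,
      Multiset.cons_erase he]
  · intro y hy
    obtain ⟨q, hq, rfl⟩ := Multiset.mem_map.1 hy
    exact ⟨f e, Multiset.mem_cons_self _ _, (Finset.mem_filter.1 hq).2⟩

theorem extremePoints_Ici {𝕜 E : Type*} [Field 𝕜] [LinearOrder 𝕜] [IsStrictOrderedRing 𝕜]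
    [AddCommGroup E] [PartialOrder E] [IsOrderedAddMonoid E] [Module 𝕜 E] [PosSMulMono 𝕜 E]
    (v : E) : Set.extremePoints 𝕜 (Set.Ici v) = {v} := by
  refine Set.eq_singleton_iff_unique_mem.2
    ⟨mem_extremePoints_iff_left.2 ⟨Set.self_mem_Ici, fun x hx y hy hv => ?_⟩, fun w hw => ?_⟩
  · obtain ⟨a, b, ha, hb, hab, hv⟩ := hv
    have hsum : a • (x - v) + b • (y - v) = 0 := by
      rw [smul_sub, smul_sub, sub_add_sub_comm, hv, ← add_smul, hab, one_smul, sub_self]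
    have hx0 := ((add_eq_zero_iff_of_nonneg (smul_nonneg ha.le (sub_nonneg.2 hx))
      (smul_nonneg hb.le (sub_nonneg.2 hy))).1 hsum).1
    exact sub_eq_zero.1 ((smul_eq_zero_iff_right ha.ne').1 hx0)
  · have hvw : v ≤ w := extremePoints_subset hw
    -- `w` is the midpoint of `v` and `w + (w - v)`
    refine (mem_extremePoints_iff_left.1 hw).2 v Set.self_mem_Ici (w + (w - v))
      (le_add_of_le_of_nonneg hvw (sub_nonneg.2 hvw)) ?_ |>.symm
    refine ⟨1 / 2, 1 / 2, by positivity, by positivity, add_halves 1, ?_⟩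
    module

theorem isUpperSet_positiveHull {ι : Type*} (A : Set (ι → ℝ)) : IsUpperSet (positiveHull A) := by
  intro x y hxy hx
  rw [← positiveHull_positiveHull]
  exact subset_convexHull ℝ _ ⟨x, hx, y - x, Set.mem_Ici.2 (sub_nonneg.2 hxy), add_sub_cancel _ _⟩

theorem positiveHull_eq_Ici {ι : Type*} {A : Set (ι → ℝ)} {v : ι → ℝ} (h : IsLeast A v) :
    positiveHull A = Set.Ici v := by
  refine subset_antisymm (convexHull_min ?_ (convex_Ici v)) fun x hx =>
    isUpperSet_positiveHull A hx (subset_positiveHull A h.1)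
  rintro _ ⟨a, ha, b, hb, rfl⟩
  exact (h.2 ha).trans (le_add_of_nonneg_right hb)

/-- The exponent vector on `I ∪ {∞}` of the pull-back, under the blow-up centered in `J`, of the
monomial with exponent vector `x`. -/
def blowUpExponent {I : Type*} (J : Finset I) (x : I → ℕ) : Option I → ℕ
  | some i => x i
  | none => ∑ j ∈ J, x j

theorem blowUpExponent_le {I : Type*} [DecidableEq I] {J : Finset I} {J' : Finset (Option I)}
    {x y : I → ℕ} (h : ∀ i ∈ SupportFabric.blowUpProj J J', x i ≤ y i) :
    ∀ i ∈ J', blowUpExponent J x i ≤ blowUpExponent J y i := by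
  rintro (_ | i) hi
  · exact Finset.sum_le_sum fun j hj => h j (SupportFabric.subset_blowUpProj hi hj)
  · exact h i (SupportFabric.eraseNone_subset_blowUpProj J J' (Finset.mem_eraseNone.2 hi))

/-- The point of `ℝ^J` with coordinates `x j / d`: an exponent vector on the whole index set stands
for one point of `(1/d) ℤ^J` for each stratum `J`. -/
noncomputable def exponentPoint {I : Type*} (d : ℕ) (J : Finset I) (x : I → ℕ) : J → ℝ :=
  fun j => (x j : ℝ) / d

theorem exponentPoint_le {I : Type*} (d : ℕ) {J : Finset I} {x y : I → ℕ}
    (h : ∀ j ∈ J, x j ≤ y j) : exponentPoint d J x ≤ exponentPoint d J y := fun j =>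
  div_le_div_of_nonneg_right (Nat.cast_le.2 (h j j.2)) d.cast_nonneg

theorem blowUpMap_exponentPoint {I : Type*} [DecidableEq I] (d : ℕ) (J : Finset I)
    (J' : Finset (Option I)) (x : I → ℕ) :
    blowUpMap J J' (exponentPoint d _ x) = exponentPoint d J' (blowUpExponent J x) := by
  funext k
  rcases k with ⟨_ | i, h⟩
  · change ∑ j : J, (x j : ℝ) / d = ((∑ j ∈ J, x j : ℕ) : ℝ) / d
    rw [Nat.cast_sum, Finset.sum_div, Finset.sum_coe_sort J fun j => (x j : ℝ) / d]
  · rfl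

namespace SupportFabric

variable {F : SupportFabric} {x y : F.Idx → ℕ}

/-- On each stratum, one of the monomials with exponent vectors `x` and `y` divides the other. -/
def ComparableOnStrata (F : SupportFabric) (x y : F.Idx → ℕ) : Prop :=
  ∀ J ∈ F.strata, (∀ j ∈ J, x j ≤ y j) ∨ ∀ j ∈ J, y j ≤ x j

theorem ComparableOnStrata.blowUp (h : F.ComparableOnStrata x y) (J : Finset F.Idx) :
    (F.blowUp J).ComparableOnStrata (blowUpExponent J x) (blowUpExponent J y) := fun _ hJ' =>
  (h _ (F.blowUpProj_mem J hJ')).imp blowUpExponent_le blowUpExponent_le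

open scoped Classical in
/-- The minimal obstructions to `ComparableOnStrata`: the edges of the fabric along which neither
monomial divides the other, oriented so that `x` is the smaller one at the first vertex. -/
noncomputable def conflicts (F : SupportFabric) (x y : F.Idx → ℕ) : Finset (F.Idx × F.Idx) :=
  {p | {p.1, p.2} ∈ F.strata ∧ x p.1 < y p.1 ∧ y p.2 < x p.2}

theorem mem_conflicts {i j : F.Idx} :
    (i, j) ∈ F.conflicts x y ↔ {i, j} ∈ F.strata ∧ x i < y i ∧ y j < x j := by
  simp only [conflicts, Finset.mem_filter_univ]

theorem ne_of_mem_conflicts {i j : F.Idx} (h : (i, j) ∈ F.conflicts x y) : i ≠ j := by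
  rintro rfl
  obtain ⟨-, hi, hi'⟩ := mem_conflicts.1 h
  exact hi.asymm hi'

theorem comparableOnStrata_of_conflicts_eq_empty (h : F.conflicts x y = ∅) :
    F.ComparableOnStrata x y := by
  intro J hJ
  by_contra! hc
  obtain ⟨⟨j, hj, hyx⟩, i, hi, hxy⟩ := hc
  have hij : {i, j} ⊆ J := Finset.insert_subset hi (Finset.singleton_subset_iff.2 hj)
  exact Finset.eq_empty_iff_forall_notMem.1 h (i, j)
    (mem_conflicts.2 ⟨F.isOpen_strata J hJ _ hij, hxy, hyx⟩)

/-- The size of the conflict `p` between the exponent vectors `x` and `y`. No truncation occurs in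
the differences when `p` is a conflict. -/
def gap {I : Type*} (x y : I → ℕ) (p : I × I) : ℕ := (y p.1 - x p.1) + (x p.2 - y p.2)

section BlowUpConflict

variable {i j k l : F.Idx}

theorem mem_conflicts_of_blowUp_some_some
    (h : (some k, some l) ∈ (F.blowUp {i, j}).conflicts (blowUpExponent {i, j} x)
      (blowUpExponent {i, j} y)) :
    (k, l) ∈ F.conflicts x y ∧ (k, l) ≠ (i, j) := by
  obtain ⟨hs, hk, hl⟩ := mem_conflicts.1 h
  obtain ⟨hnot, hmem⟩ := (F.mem_blowUpStrata _ _).1 hs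
  refine ⟨mem_conflicts.2 ⟨F.isOpen_strata _ hmem _ ?_, hk, hl⟩, ?_⟩
  · simp [blowUpProj, Finset.insert_subset_iff]
  · rintro ⟨⟩
    exact hnot (by simp [Finset.insert_subset_iff])

theorem mem_conflicts_of_blowUp_none_some (hij : (i, j) ∈ F.conflicts x y)
    (h : (none, some l) ∈ (F.blowUp {i, j}).conflicts (blowUpExponent {i, j} x)
      (blowUpExponent {i, j} y)) :
    (i, l) ∈ F.conflicts x y ∧
      gap (blowUpExponent {i, j} x) (blowUpExponent {i, j} y) (none, some l) < gap x y (i, l) := by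
  obtain ⟨-, hi, hj⟩ := mem_conflicts.1 hij
  obtain ⟨hs, h_infty, hl⟩ := mem_conflicts.1 h
  have hmem := ((F.mem_blowUpStrata _ _).1 hs).2
  refine ⟨mem_conflicts.2 ⟨F.isOpen_strata _ hmem _ ?_, hi, hl⟩, ?_⟩
  · simp [blowUpProj, Finset.insert_subset_iff]
  · simp only [gap, blowUpExponent, Finset.sum_pair (ne_of_mem_conflicts hij)] at h_infty ⊢
    omega

theorem mem_conflicts_of_blowUp_some_none (hij : (i, j) ∈ F.conflicts x y)
    (h : (some k, none) ∈ (F.blowUp {i, j}).conflicts (blowUpExponent {i, j} x)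
      (blowUpExponent {i, j} y)) :
    (k, j) ∈ F.conflicts x y ∧
      gap (blowUpExponent {i, j} x) (blowUpExponent {i, j} y) (some k, none) < gap x y (k, j) := by
  obtain ⟨-, hi, hj⟩ := mem_conflicts.1 hij
  obtain ⟨hs, hk, h_infty⟩ := mem_conflicts.1 h
  have hmem := ((F.mem_blowUpStrata _ _).1 hs).2
  refine ⟨mem_conflicts.2 ⟨F.isOpen_strata _ hmem _ ?_, hk, hj⟩, ?_⟩
  · simp [blowUpProj, Finset.insert_subset_iff]
  · simp only [gap, blowUpExponent, Finset.sum_pair (ne_of_mem_conflicts hij)] at h_infty ⊢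
    omega

theorem isDershowitzMannaLT_gaps_blowUp (hij : (i, j) ∈ F.conflicts x y)
    (hmax : ∀ p ∈ F.conflicts x y, gap x y p ≤ gap x y (i, j)) :
    (((F.blowUp {i, j}).conflicts (blowUpExponent {i, j} x) (blowUpExponent {i, j} y)).val.map
      (gap (blowUpExponent {i, j} x) (blowUpExponent {i, j} y))).IsDershowitzMannaLT
        ((F.conflicts x y).val.map (gap x y)) := by
  refine isDershowitzMannaLT_map_of_forall_lt_or_exists hij (Prod.map some some) ?_
  rintro ⟨_ | k, _ | l⟩ hq
  · exact absurd rfl (ne_of_mem_conflicts hq)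
  · obtain ⟨hil, hlt⟩ := mem_conflicts_of_blowUp_none_some hij hq
    exact .inl (hlt.trans_le (hmax _ hil))
  · obtain ⟨hkj, hlt⟩ := mem_conflicts_of_blowUp_some_none hij hq
    exact .inl (hlt.trans_le (hmax _ hkj))
  · obtain ⟨hkl, hne⟩ := mem_conflicts_of_blowUp_some_some hq
    exact .inr ⟨(k, l), hkl, hne, rfl, rfl⟩

end BlowUpConflict

end SupportFabric

universe u

/-- A family of monomials on a support fabric, given by their exponent vectors. It carries the data
of a polyhedra system in the finite form on which blow-ups are easiest to follow. -/
structure MonomialFamily (ι : Type*) where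
  fabric : SupportFabric.{u}
  exponent : ι → fabric.Idx → ℕ

namespace MonomialFamily

open Relation SupportFabric PolyhedraSystem

variable {ι : Type*} {W W' : MonomialFamily ι}

/-- The pull-back of a family of monomials under the blow-up centered in `J`. -/
def blowUp (W : MonomialFamily ι) (J : Finset W.fabric.Idx) : MonomialFamily ι where
  fabric := W.fabric.blowUp J
  exponent a := blowUpExponent J (W.exponent a)

/-- `W'` is the blow-up of `W` centered in some non-empty stratum. -/
def IsBlowUp (W W' : MonomialFamily ι) : Prop :=
  ∃ J ∈ W.fabric.strata, J.Nonempty ∧ W' = W.blowUp J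

/-- On each stratum, one of the monomials of index `a` and `b` divides the other. -/
def Comparable (W : MonomialFamily ι) (a b : ι) : Prop :=
  W.fabric.ComparableOnStrata (W.exponent a) (W.exponent b)

theorem Comparable.of_reflTransGen {a b : ι} (h : W.Comparable a b)
    (hW : ReflTransGen IsBlowUp W W') : W'.Comparable a b := by
  induction hW with
  | refl => exact h
  | tail _ hstep ih =>
    obtain ⟨J, -, -, rfl⟩ := hstep
    exact ComparableOnStrata.blowUp ih J

/-- The multiset of gaps of the conflicts between two members of a family, which measures how far
they are from being comparable. -/
noncomputable def gaps (a b : ι) (W : MonomialFamily ι) : Multiset ℕ :=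
  (W.fabric.conflicts (W.exponent a) (W.exponent b)).val.map (gap (W.exponent a) (W.exponent b))

theorem exists_isBlowUp_gaps_lt {a b : ι} (h : ¬ W.Comparable a b) :
    ∃ W', W.IsBlowUp W' ∧ (gaps a b W').IsDershowitzMannaLT (gaps a b W) := by
  have hne : (W.fabric.conflicts (W.exponent a) (W.exponent b)).Nonempty :=
    Finset.nonempty_iff_ne_empty.2 fun h0 => h (comparableOnStrata_of_conflicts_eq_empty h0)
  obtain ⟨⟨i, j⟩, hij, hmax⟩ := Finset.exists_max_image _ (gap (W.exponent a) (W.exponent b)) hne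
  exact ⟨W.blowUp {i, j}, ⟨_, (mem_conflicts.1 hij).1, Finset.insert_nonempty _ _, rfl⟩,
    isDershowitzMannaLT_gaps_blowUp hij hmax⟩

theorem exists_reflTransGen_comparable (a b : ι) (W : MonomialFamily ι) :
    ∃ W', ReflTransGen IsBlowUp W W' ∧ W'.Comparable a b := by
  induction W using (InvImage.wf (gaps a b) Multiset.wellFounded_isDershowitzMannaLT).induction with
  | _ W ih =>
  by_cases h : W.Comparable a b
  · exact ⟨W, .refl, h⟩
  · obtain ⟨W₁, hW₁, hlt⟩ := exists_isBlowUp_gaps_lt h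
    obtain ⟨W', hW', h'⟩ := ih W₁ hlt
    exact ⟨W', hW'.head hW₁, h'⟩

theorem exists_reflTransGen_forall_comparable [Finite ι] (W : MonomialFamily ι) :
    ∃ W', ReflTransGen IsBlowUp W W' ∧ ∀ a b, W'.Comparable a b := by
  suffices hS : ∀ S : Set (ι × ι), S.Finite →
      ∃ W', ReflTransGen IsBlowUp W W' ∧ ∀ p ∈ S, W'.Comparable p.1 p.2 by
    obtain ⟨W', hW', h⟩ := hS _ Set.finite_univ
    exact ⟨W', hW', fun a b => h (a, b) trivial⟩
  intro S hS
  induction S, hS using Set.Finite.induction_on with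
  | empty => exact ⟨W, .refl, fun _ => False.elim⟩
  | @insert p S _ _ ih =>
    obtain ⟨W₁, hW₁, hS⟩ := ih
    obtain ⟨W₂, hW₂, hp⟩ := exists_reflTransGen_comparable p.1 p.2 W₁
    exact ⟨W₂, hW₁.trans hW₂,
      Set.forall_mem_insert.2 ⟨hp, fun q hq => (hS q hq).of_reflTransGen hW₂⟩⟩

variable {d : ℕ} (hd : 0 < d)

/-- The polyhedra system with denominator `d` spanned by a family of monomials. -/
noncomputable abbrev system (W : MonomialFamily ι) : PolyhedraSystem d where
  fabric := W.fabric
  denom_pos := hd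
  poly J := positiveHull (Set.range fun a => exponentPoint d J.1 (W.exponent a))
  isCharPolyhedron J := by
    refine ⟨_, ?_, rfl⟩
    rintro _ ⟨a, rfl⟩ j
    exact ⟨_, rfl⟩
  compat J₁ J₂ h := by
    rw [restrict_image_positiveHull, ← Set.range_comp]
    rfl

theorem eq_system_of_poly_eq {D : PolyhedraSystem d} {m : ι → D.fabric.Idx → ℕ}
    (h : ∀ J, D.poly J = positiveHull (Set.range fun a => exponentPoint d J.1 (m a))) :
    D = system D.denom_pos ⟨D.fabric, m⟩ := by
  cases D
  dsimp only [system]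
  congr 1
  exact funext h

theorem totalPoly_system (W : MonomialFamily ι) (J : Finset W.fabric.Idx)
    (J' : W.fabric.blowUpStrata J) :
    (system hd W).totalPoly J J' = positiveHull
      (Set.range fun a => exponentPoint d J'.1 (blowUpExponent J (W.exponent a))) := by
  rw [totalPoly_eq, positiveHull_image_positiveHull _ (blowUpMap_nonneg J J'.1), ← Set.range_comp]
  exact congrArg positiveHull
    (congrArg Set.range (funext fun a => blowUpMap_exponentPoint d J J'.1 (W.exponent a)))

theorem totalTransform_system (W : MonomialFamily ι) (J : Finset W.fabric.Idx) :
    (system hd W).totalTransform J = system hd (W.blowUp J) :=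
  eq_system_of_poly_eq (D := (system hd W).totalTransform J) (totalPoly_system hd W J)

theorem reflTransGen_isTotalTransform_system (h : ReflTransGen IsBlowUp W W') :
    ReflTransGen PolyhedraSystem.IsTotalTransform (system hd W) (system hd W') := by
  refine h.lift (system hd) ?_
  rintro W _ ⟨J, hJ, hne, rfl⟩
  exact ⟨J, hJ, hne, (totalTransform_system hd W J).symm⟩

theorem exists_poly_system_eq_Ici [Finite ι] [Nonempty ι] (h : ∀ a b, W.Comparable a b)
    (J : (system hd W).fabric.strata) : ∃ v, (system hd W).poly J = Set.Ici v := by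
  have hchain : IsChain (· ≤ ·) (Set.range fun a => exponentPoint d J.1 (W.exponent a)) := by
    rintro _ ⟨a, rfl⟩ _ ⟨b, rfl⟩ -
    exact (h a b J.1 J.2).imp (exponentPoint_le d) (exponentPoint_le d)
  obtain ⟨v, hv⟩ := exists_isLeast_of_isChain (Set.finite_range _) (Set.range_nonempty _) hchain
  exact ⟨v, positiveHull_eq_Ici hv⟩

end MonomialFamily

namespace PolyhedraSystem

variable {d : ℕ} (D : PolyhedraSystem d)

theorem positiveHull_poly (J : D.fabric.strata) : positiveHull (D.poly J) = D.poly J := by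
  obtain ⟨A, -, hA⟩ := D.isCharPolyhedron J
  rw [hA, positiveHull_positiveHull]

theorem isUpperSet_poly (J : D.fabric.strata) : IsUpperSet (D.poly J) :=
  D.positiveHull_poly J ▸ isUpperSet_positiveHull _

theorem exists_mem_poly_eqOn_inter {J : D.fabric.strata} {σ : J.1 → ℝ} (hσ : σ ∈ D.poly J)
    (K : D.fabric.strata) :
    ∃ τ ∈ D.poly K, ∀ i (hJ : i ∈ J.1) (hK : i ∈ K.1), τ ⟨i, hK⟩ = σ ⟨i, hJ⟩ := by
  let L : D.fabric.strata :=
    ⟨J.1 ∩ K.1, D.fabric.isOpen_strata _ J.2 _ Finset.inter_subset_left⟩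
  have hL : Finset.restrict₂ (π := fun _ => ℝ) Finset.inter_subset_left σ ∈ D.poly L := by
    rw [D.compat L J Finset.inter_subset_left]
    exact ⟨σ, hσ, rfl⟩
  rw [D.compat L K Finset.inter_subset_right] at hL
  obtain ⟨τ, hτ, hτσ⟩ := hL
  exact ⟨τ, hτ, fun i hJ hK => congrFun hτσ ⟨i, Finset.mem_inter.2 ⟨hJ, hK⟩⟩⟩

/-- The exponent vectors whose points lie in all the polyhedra of the system. -/
def commonExponents : Set (D.fabric.Idx → ℕ) :=
  {x | ∀ J, exponentPoint d J.1 x ∈ D.poly J}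

theorem exists_mem_commonExponents_eqOn {J : D.fabric.strata} {b : D.fabric.Idx → ℕ}
    (hb : exponentPoint d J.1 b ∈ D.poly J) :
    ∃ x ∈ D.commonExponents, ∀ j ∈ J.1, x j = b j := by
  choose τ hτ hτb using D.exists_mem_poly_eqOn_inter hb
  obtain ⟨n, hn⟩ := exists_nat_forall_le_div (Nat.cast_pos.2 D.denom_pos)
    fun p : Σ K : D.fabric.strata, K.1 => τ p.1 p.2
  refine ⟨J.1.piecewise b fun _ => n, fun K => D.isUpperSet_poly K (fun k => ?_) (hτ K),
    fun j hj => Finset.piecewise_eq_of_mem _ _ _ hj⟩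
  by_cases hk : k.1 ∈ J.1
  · rw [hτb K k hk k.2, exponentPoint, exponentPoint, Finset.piecewise_eq_of_mem _ _ _ hk]
  · rw [exponentPoint, Finset.piecewise_eq_of_notMem _ _ _ hk]
    exact hn ⟨K, k⟩

theorem commonExponents_nonempty (hD : ∀ J, (D.poly J).Nonempty) : D.commonExponents.Nonempty := by
  choose τ hτ using hD
  obtain ⟨n, hn⟩ := exists_nat_forall_le_div (Nat.cast_pos.2 D.denom_pos)
    fun p : Σ K : D.fabric.strata, K.1 => τ p.1 p.2
  exact ⟨fun _ => n, fun K => D.isUpperSet_poly K (fun k => hn ⟨K, k⟩) (hτ K)⟩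

theorem exists_poly_eq_positiveHull_exponentPoint (J : D.fabric.strata) :
    ∃ B : Set (D.fabric.Idx → ℕ), D.poly J = positiveHull (exponentPoint d J.1 '' B) := by
  obtain ⟨A, hA, hJ⟩ := D.isCharPolyhedron J
  refine ⟨exponentPoint d J.1 ⁻¹' A, ?_⟩
  rw [hJ, Set.image_preimage_eq_of_subset]
  intro a ha
  choose n hn using hA a ha
  refine ⟨Function.extend Subtype.val n 0, funext fun j => ?_⟩
  rw [exponentPoint, Subtype.val_injective.extend_apply, hn j]

/-- The monomials that are minimal for divisibility among the common exponents of the system: a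
finite family that spans all of its polyhedra. -/
def minimalFamily : MonomialFamily {x // Minimal (· ∈ D.commonExponents) x} :=
  ⟨D.fabric, Subtype.val⟩

instance finite_minimal_commonExponents : Finite {x // Minimal (· ∈ D.commonExponents) x} :=
  finite_setOf_minimal _

theorem nonempty_minimal_commonExponents (hD : ∀ J, (D.poly J).Nonempty) :
    Nonempty {x // Minimal (· ∈ D.commonExponents) x} :=
  let ⟨x, hx⟩ := D.commonExponents_nonempty hD
  let ⟨y, _, hy⟩ := exists_minimal_le_of_wellFoundedLT (· ∈ D.commonExponents) x hx
  ⟨⟨y, hy⟩⟩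

theorem eq_system_minimalFamily : D = D.minimalFamily.system D.denom_pos := by
  refine MonomialFamily.eq_system_of_poly_eq fun J => subset_antisymm ?_ ?_
  · obtain ⟨B, hB⟩ := D.exists_poly_eq_positiveHull_exponentPoint J
    rw [← positiveHull_positiveHull (Set.range _), hB]
    refine positiveHull_mono ?_
    rintro _ ⟨b, hb, rfl⟩
    obtain ⟨x, hx, hxb⟩ := D.exists_mem_commonExponents_eqOn
      (hB ▸ subset_positiveHull _ (Set.mem_image_of_mem _ hb))
    obtain ⟨y, hyx, hy⟩ := exists_minimal_le_of_wellFoundedLT (· ∈ D.commonExponents) x hx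
    exact isUpperSet_positiveHull _ (exponentPoint_le d fun j hj => (hyx j).trans (hxb j hj).le)
      (subset_positiveHull _ ⟨⟨y, hy⟩, rfl⟩)
  · rw [← D.positiveHull_poly J]
    refine positiveHull_mono ?_
    rintro _ ⟨x, rfl⟩
    exact x.2.1 J

end PolyhedraSystem

theorem mainTheorem2_general {d : ℕ} (D : PolyhedraSystem d) (hD : ∀ J, (D.poly J).Nonempty) :
    ∃ D' : PolyhedraSystem d,
      Relation.ReflTransGen PolyhedraSystem.IsTotalTransform D D' ∧
        ∀ J, ∃ v, D'.poly J = Set.Ici v := by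
  have := D.nonempty_minimal_commonExponents hD
  obtain ⟨W', hW', hcomp⟩ := D.minimalFamily.exists_reflTransGen_forall_comparable
  have hD' := MonomialFamily.reflTransGen_isTotalTransform_system D.denom_pos hW'
  rw [← D.eq_system_minimalFamily] at hD'
  exact ⟨_, hD', MonomialFamily.exists_poly_system_eq_Ici D.denom_pos hcomp⟩

theorem mainTheorem2 (N : NewtonPolyhedraSystem) (hN : ∀ J, (N.poly J).Nonempty) :
    ∃ N' : NewtonPolyhedraSystem,
      Relation.ReflTransGen PolyhedraSystem.IsTotalTransform N N' ∧ N'.HasNormalCrossings :=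
  let ⟨N', hN', hpoly⟩ := mainTheorem2_general N hN
  ⟨N', hN', fun J => (hpoly J).imp fun v hv => by rw [hv, extremePoints_Ici]⟩
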